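/- Let $E\to M$ be a Courant algebroid over a smooth manifold $M$ of dimension $n>0$, with anchor $\pi\colon E\to TM$, fibrewise nondegenerate symmetric pairing $\langle\cdot,\cdot\rangle$ of arbitrary signature and bracket $[\cdot,\cdot]$ on $\Gamma(E)$, satisfying for $a,b,c\in\Gamma(E)$, $f\in C^\infty(M)$: $[a,[b,c]]=[[a,b],c]+[b,[a,c]]$, $\pi([a,b])=[\pi(a),\pi(b)]$, $[a,fb]=\pi(a)(f)b+f[a,b]$, $\pi(a)\langle b,c\rangle=\langle[a,b],c\rangle+\langle b,[a,c]\rangle$ and $2\langle[a,a],b\rangle=\pi(b)\langle a,a\rangle$. Let $E=V_+\oplus V_-$ be a generalized metric, i.e. an orthogonal decomposition into smooth subbundles (equivalently, a smooth symmetric endomorphism $G$ of $E$ with $G^2=\mathrm{Id}$ and $\pm1$-eigenbundles $V_\pm$). A generalized connection is an $\mathbb R$-linear operator $D\colon\Gamma(E)\to\Gamma(E^*\otimes E)$ with $D_a(fb)=\pi(a)(f)b+fD_ab$ and $\pi(a)\langle b,c\rangle=\langle D_ab,c\rangle+\langle b,D_ac\rangle$. It is $V_+$-compatible if $D(\Gamma(V_\pm))\subset\Gamma(E^*\otimes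 V_\pm)$. Its divergence is $\mathrm{div}_D(e)=\mathrm{tr}(a\mapsto D_ae)$ and its torsion is $T_D(a,b,c)=\langle D_ab-D_ba-[a,b],c\rangle+\langle D_ca,b\rangle$; the torsion is of pure type if $T_D\in\Gamma(\Lambda^3V_+^*\oplus\Lambda^3V_-^*)$. The Ricci tensors $Ric^\pm_D\in\Gamma(V_\mp^*\otimes V_\pm^*)$ of a $V_+$-compatible $D$ are $$Ric_D^\pm(e^\mp,e^\pm)=\mathrm{tr}_{V_\pm}\big(d^\pm\mapsto D_{d^\pm}D_{e^\mp}e^\pm-D_{e^\mp}D_{d^\pm}e^\pm-D_{[d^\pm,e^\mp]}e^\pm\big).$$ (i) Let $D,D'$ be $V_+$-compatible generalized connections with $\mathrm{div}_D=\mathrm{div}_{D'}$. If $T_D=0$ and $T_{D'}$ is of pure type, then $Ric^+_D=Ric^+_{D'}$ and $Ric^-_D=Ric^-_{D'}$. (ii) Consequently the Ricci tensors of a pair $(V_+,\mathrm{div})$ are well defined: let $\mathrm{div}\colon\Gamma(E)\to C^\infty(M)$ be a divergence operator, i.e. $\mathbb R$-linear with $\mathrm{div}(fe)=\pi(e)(f)+f\,\mathrm{div}(e)$,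 and let $\mathcal D(V_+,\mathrm{div})$ be the set of $V_+$-compatible generalized connections $D$ with $T_D=0$ and $\mathrm{div}_D=\mathrm{div}$. If $\mathcal D(V_+,\mathrm{div})$ is non-empty, there are unique tensors $Ric^\pm\in\Gamma(V_\mp^*\otimes V_\pm^*)$ with $Ric^\pm_D=Ric^\pm$ for every $D\in\mathcal D(V_+,\mathrm{div})$. -/

import Mathlib

open scoped Manifold ContDiff Topology Bundle

set_option linter.unusedSectionVars false

noncomputable section

namespace GenGeom

/-- Smooth real functions on an `n`-dimensional manifold `M` (without boundary). -/
abbrev SmoothFn (n : ℕ) (M : Type*) [TopologicalSpace M]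
    [ChartedSpace (EuclideanSpace ℝ (Fin n)) M] : Type _ :=
  ContMDiffMap (𝓡 n) 𝓘(ℝ, ℝ) M ℝ ∞

/-- Smooth sections `Γ(E)` of a vector bundle `E → M` with model fibre `F`. -/
abbrev Sec (n : ℕ) {M : Type*} [TopologicalSpace M]
    [ChartedSpace (EuclideanSpace ℝ (Fin n)) M]
    (F : Type*) [NormedAddCommGroup F] [NormedSpace ℝ F]
    (E : M → Type*) [TopologicalSpace (Bundle.TotalSpace F E)]
    [∀ x, TopologicalSpace (E x)] [FiberBundle F E] : Type _ :=
  ContMDiffSection (𝓡 n) F ∞ E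

section Modules

variable {n : ℕ} {M : Type*} [TopologicalSpace M]
  [ChartedSpace (EuclideanSpace ℝ (Fin n)) M]
  {F : Type*} [NormedAddCommGroup F] [NormedSpace ℝ F]
  {E : M → Type*} [TopologicalSpace (Bundle.TotalSpace F E)]
  [∀ x, AddCommGroup (E x)] [∀ x, Module ℝ (E x)]
  [∀ x, TopologicalSpace (E x)] [FiberBundle F E] [VectorBundle ℝ F E]

/-- Pointwise multiplication of sections by smooth functions. -/
instance instSMulSec : SMul (SmoothFn n M) (Sec n F E) :=
  ⟨fun f s => ⟨fun x => f x • s x, f.contMDiff.smul_section s.contMDiff⟩⟩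

@[simp] theorem sec_smul_apply (f : SmoothFn n M) (s : Sec n F E) (x : M) :
    (f • s) x = f x • s x := rfl

@[simp] theorem sec_add_apply (s t : Sec n F E) (x : M) : (s + t) x = s x + t x := rfl
@[simp] theorem sec_sub_apply (s t : Sec n F E) (x : M) : (s - t) x = s x - t x := rfl
@[simp] theorem sec_rsmul_apply (r : ℝ) (s : Sec n F E) (x : M) : (r • s) x = r • s x := rfl
@[simp] theorem sec_zero_apply (x : M) : (0 : Sec n F E) x = 0 := rfl

/-- `Γ(E)` is a module over `C^∞(M)`. -/
instance instModuleSec : Module (SmoothFn n M) (Sec n F E) where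
  one_smul s := by ext x; simp
  mul_smul f g s := by ext x; simp [mul_smul]
  smul_zero f := by ext x; simp
  smul_add f s t := by ext x; simp
  add_smul f g s := by ext x; simp [add_smul]
  zero_smul s := by ext x; simp

end Modules

/-- The derivative `v(f)` of a real function `f` along the tangent vector `v ∈ T_x M`. -/
def derivAlong {n : ℕ} {M : Type*} [TopologicalSpace M]
    [ChartedSpace (EuclideanSpace ℝ (Fin n)) M] (f : M → ℝ) (x : M)
    (v : TangentSpace (𝓡 n) x) : ℝ :=
  mfderiv (𝓡 n) 𝓘(ℝ, ℝ) f x v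

/-- A Courant algebroid structure on the smooth vector bundle `E → M` (model fibre `F`) over the
`n`-dimensional manifold `M`. -/
structure CourantAlgebroid (n : ℕ) {M : Type*} [TopologicalSpace M]
    [ChartedSpace (EuclideanSpace ℝ (Fin n)) M] [IsManifold (𝓡 n) ∞ M]
    (F : Type*) [NormedAddCommGroup F] [NormedSpace ℝ F]
    (E : M → Type*) [TopologicalSpace (Bundle.TotalSpace F E)]
    [∀ x, AddCommGroup (E x)] [∀ x, Module ℝ (E x)] [∀ x, TopologicalSpace (E x)]
    [∀ x, IsTopologicalAddGroup (E x)] [∀ x, ContinuousSMul ℝ (E x)]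
    [FiberBundle F E] [VectorBundle ℝ F E] where
  /-- The pairing, a smooth field of bilinear forms. -/
  pairing : Sec n (F →L[ℝ] F →L[ℝ] ℝ) (fun x : M => E x →L[ℝ] E x →L[ℝ] ℝ)
  pairing_symm : ∀ (x : M) (v w : E x), pairing x v w = pairing x w v
  pairing_nondegenerate : ∀ (x : M) (v : E x), (∀ w, pairing x v w = 0) → v = 0
  /-- The anchor `π : E → TM`. -/
  anchor : Sec n (F →L[ℝ] EuclideanSpace ℝ (Fin n))
    (fun x : M => E x →L[ℝ] TangentSpace (𝓡 n) x)
  /-- The (Dorfman) bracket. -/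
  bracket : Sec n F E →ₗ[ℝ] Sec n F E →ₗ[ℝ] Sec n F E
  jacobi : ∀ a b c : Sec n F E,
    bracket a (bracket b c) = bracket (bracket a b) c + bracket b (bracket a c)
  anchor_bracket : ∀ (a b : Sec n F E) (x : M),
    anchor x (bracket a b x) =
      VectorField.mlieBracket (𝓡 n) (fun y => anchor y (a y)) (fun y => anchor y (b y)) x
  bracket_leibniz : ∀ (a b : Sec n F E) (f : SmoothFn n M) (x : M),
    bracket a (f • b) x =
      derivAlong f x (anchor x (a x)) • b x + f x • bracket a b x
  /-- `π(a)⟨b, c⟩ = ⟨[a, b], c⟩ + ⟨b, [a, c]⟩` -/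
  anchor_pairing : ∀ (a b c : Sec n F E) (x : M),
    derivAlong (fun y => pairing y (b y) (c y)) x (anchor x (a x)) =
      pairing x (bracket a b x) (c x) + pairing x (b x) (bracket a c x)
  /-- `2[a, a] = π^* d⟨a, a⟩`, where `E` is identified with `E^*` by the pairing -/
  two_bracket_self : ∀ (a b : Sec n F E) (x : M),
    2 * pairing x (bracket a a x) (b x) =
      derivAlong (fun y => pairing y (a y) (a y)) x (anchor x (b x))

namespace CourantAlgebroid

variable {n : ℕ} {M : Type*} [TopologicalSpace M]
    [ChartedSpace (EuclideanSpace ℝ (Fin n)) M] [IsManifold (𝓡 n) ∞ M]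
    {F : Type*} [NormedAddCommGroup F] [NormedSpace ℝ F]
    {E : M → Type*} [TopologicalSpace (Bundle.TotalSpace F E)]
    [∀ x, AddCommGroup (E x)] [∀ x, Module ℝ (E x)] [∀ x, TopologicalSpace (E x)]
    [∀ x, IsTopologicalAddGroup (E x)] [∀ x, ContinuousSMul ℝ (E x)]
    [FiberBundle F E] [VectorBundle ℝ F E]

/-- A generalized connection on `E`: an `ℝ`-linear operator `D : Γ(E) → Γ(E^* ⊗ E)` satisfying the
Leibniz rule and compatible with the pairing; `D e x v` is `(D_v e)(x)`. -/
structure GeneralizedConnection (A : CourantAlgebroid n F E) where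
  toLin : Sec n F E →ₗ[ℝ] Sec n (F →L[ℝ] F) (fun x : M => E x →L[ℝ] E x)
  leibniz : ∀ (f : SmoothFn n M) (e : Sec n F E) (x : M) (v : E x),
    toLin (f • e) x v = derivAlong f x (A.anchor x v) • e x + f x • toLin e x v
  metric : ∀ (a b : Sec n F E) (x : M) (v : E x),
    derivAlong (fun y => A.pairing y (a y) (b y)) x (A.anchor x v) =
      A.pairing x (toLin a x v) (b x) + A.pairing x (a x) (toLin b x v)

/-- A divergence operator: an `ℝ`-linear operator `Γ(E) → C^∞(M)` with
`div (f e) = π(e)(f) + f div e`. -/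
structure DivergenceOperator (A : CourantAlgebroid n F E) where
  toLin : Sec n F E →ₗ[ℝ] SmoothFn n M
  leibniz : ∀ (f : SmoothFn n M) (e : Sec n F E) (x : M),
    toLin (f • e) x = derivAlong f x (A.anchor x (e x)) + f x * toLin e x

/-- A generalized metric (of arbitrary signature): a smooth symmetric endomorphism `G` of `E` with
`G² = Id`. It is the same thing as the orthogonal decomposition `E = V_+ ⊕ V_-` into its
`±1`-eigenbundles; orthogonality makes the pairing nondegenerate on both of them. -/
structure GeneralizedMetric (A : CourantAlgebroid n F E) where
  G : Sec n (F →L[ℝ] F) (fun x : M => E x →L[ℝ] E x)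
  sq : ∀ (x : M) (v : E x), G x (G x v) = v
  symm : ∀ (x : M) (v w : E x), A.pairing x (G x v) w = A.pairing x v (G x w)

namespace GeneralizedMetric

variable {A : CourantAlgebroid n F E} (V : A.GeneralizedMetric)

/-- The fibre of `V_ε` at `x`, for a sign `ε = ±1`: the `ε`-eigenspace of `G`. -/
def fiber (ε : ℤˣ) (x : M) : Submodule ℝ (E x) where
  carrier := {v | V.G x v = ((ε : ℤ) : ℝ) • v}
  add_mem' {v w} hv hw := by
    simp only [Set.mem_ofPred_eq] at hv hw ⊢
    rw [map_add, hv, hw, smul_add]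
  zero_mem' := by simp
  smul_mem' c v hv := by
    simp only [Set.mem_ofPred_eq] at hv ⊢
    rw [map_smul, hv, smul_comm]

/-- The smooth sections `Γ(V_ε)`. -/
def secs (ε : ℤˣ) : Submodule (SmoothFn n M) (Sec n F E) where
  carrier := {e | ∀ x, e x ∈ V.fiber ε x}
  add_mem' {_ _} ha hb x := (V.fiber ε x).add_mem (ha x) (hb x)
  zero_mem' x := (V.fiber ε x).zero_mem
  smul_mem' f _ ha x := (V.fiber ε x).smul_mem (f x) (ha x)

/-- The projection `e ↦ e^ε = (e + ε G e) / 2` of `Γ(E)` onto `Γ(V_ε)`. -/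
def proj (ε : ℤˣ) (e : Sec n F E) : Sec n F E :=
  (1 / 2 : ℝ) • (e + ((ε : ℤ) : ℝ) •
    (⟨fun x => V.G x (e x), V.G.contMDiff.clm_bundle_apply e.contMDiff⟩ : Sec n F E))

/-- A `3`-tensor on `E` is of pure type if it lies in `Λ³V_+^* ⊕ Λ³V_-^*`, i.e. if it is the sum
of its restrictions to `V_+` and `V_-`. -/
def IsPureType (T : Sec n F E → Sec n F E → Sec n F E → M → ℝ) : Prop :=
  ∀ a b c : Sec n F E, T a b c =
    T (V.proj 1 a) (V.proj 1 b) (V.proj 1 c) + T (V.proj (-1) a) (V.proj (-1) b) (V.proj (-1) c)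

end GeneralizedMetric

namespace GeneralizedConnection

variable {A : CourantAlgebroid n F E} (D : A.GeneralizedConnection)

/-- `D_a b`. -/
def cov (a b : Sec n F E) : Sec n F E :=
  ⟨fun x => D.toLin b x (a x), (D.toLin b).contMDiff.clm_bundle_apply a.contMDiff⟩

/-- The divergence `div_D(e) = tr (v ↦ D_v e)`. -/
def divergence (e : Sec n F E) (x : M) : ℝ :=
  LinearMap.trace ℝ (E x) (D.toLin e x : E x →ₗ[ℝ] E x)

/-- The torsion `T_D(a, b, c) = ⟨D_a b - D_b a - [a, b], c⟩ + ⟨D_c a, b⟩`. -/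
def torsion (a b c : Sec n F E) (x : M) : ℝ :=
  A.pairing x ((D.cov a b - D.cov b a - A.bracket a b) x) (c x) + A.pairing x (D.cov c a x) (b x)

/-- The curvature `R_D(a, b)c = D_a D_b c - D_b D_a c - D_{[a, b]} c`. It is used for `a ∈ Γ(V_±)`,
`b ∈ Γ(V_∓)` and `c ∈ Γ(V_±)`, where it is tensorial. -/
def curvature (a b c : Sec n F E) : Sec n F E :=
  D.cov a (D.cov b c) - D.cov b (D.cov a c) - D.cov (A.bracket a b) c

/-- `D` is compatible with the generalized metric: `D(Γ(V_±)) ⊆ Γ(E^* ⊗ V_±)`. -/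
def IsCompatible (V : A.GeneralizedMetric) : Prop :=
  ∀ (ε : ℤˣ), ∀ e ∈ V.secs ε, ∀ (x : M) (v : E x), D.toLin e x v ∈ V.fiber ε x

end GeneralizedConnection

section Tensoriality

/-- Near every point there is a frame of global sections, with globally smooth coefficients. -/
theorem exists_frame [FiniteDimensional ℝ F] [ContMDiffVectorBundle ∞ F E (𝓡 n)] [T2Space M]
    (x₀ : M) :
    ∃ U ∈ 𝓝 x₀, ∃ (s : Fin (Module.finrank ℝ F) → Sec n F E)
      (b : ∀ x ∈ U, Module.Basis (Fin (Module.finrank ℝ F)) ℝ (E x)),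
      (∀ x hx i, b x hx i = s i x) ∧
      ∀ (t : Sec n F E) (i : Fin (Module.finrank ℝ F)),
        ∃ g : SmoothFn n M, ∀ x hx, (b x hx).repr (t x) i = g x := by
  have : ContMDiffVectorBundle 1 F E (𝓡 n) :=
    ContMDiffVectorBundle.of_le (n := ∞) (by norm_cast)
  set e := trivializationAt F E x₀
  have hx₀ : x₀ ∈ e.baseSet := FiberBundle.mem_baseSet_trivializationAt F E x₀
  let β := Module.finBasis ℝ F
  obtain ⟨ψ, -, hψ⟩ := (SmoothBumpFunction.nhds_basis_tsupport (I := 𝓡 n) x₀).mem_iff.1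
    (e.open_baseSet.mem_nhds hx₀)
  refine ⟨{x | x ∈ e.baseSet ∧ ψ x = 1}, ?_, fun i => ⟨fun x => ψ x • e.localFrame β i x, ?_⟩,
    fun x hx => e.basisAt β hx.1, ?_, ?_⟩
  · filter_upwards [e.open_baseSet.mem_nhds hx₀, ψ.eventuallyEq_one] with x h1 h2
    exact ⟨h1, h2⟩
  · exact ContMDiffOn.smul_section_of_tsupport (s := e.localFrame β i) ψ.contMDiff.contMDiffOn
      e.open_baseSet hψ (e.contMDiffOn_localFrame_baseSet ∞ β i)
  · intro x hx i
    simp [hx.1, hx.2]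
  · intro t i
    refine ⟨⟨fun x => ψ x * e.localFrameCoeff (𝓡 n) β i x (t x), ?_⟩, ?_⟩
    · refine contMDiff_of_tsupport fun x hx => ?_
      have hx' : x ∈ e.baseSet := hψ (tsupport_mul_subset_left hx)
      exact ψ.contMDiffAt.mul (contMDiffAt_localFrameCoeff (k := ∞) β hx' t.contMDiff.contMDiffAt i)
    · intro x hx
      have := e.localFrameCoeff_apply_of_mem_baseSet (I := 𝓡 n) β hx.1 t i
      change _ = ψ x * e.localFrameCoeff (𝓡 n) β i x (t x)
      rw [hx.2, this, one_mul]

variable [FiniteDimensional ℝ F] [ContMDiffVectorBundle ∞ F E (𝓡 n)] [T2Space M]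

/-- Every vector of the bundle is the value of a global section. -/
theorem exists_sec (x₀ : M) (v : E x₀) : ∃ s : Sec n F E, s x₀ = v := by
  obtain ⟨U, hU, s, b, hb, -⟩ := exists_frame (n := n) (F := F) (E := E) x₀
  have h := mem_of_mem_nhds hU
  refine ⟨∑ i, ((b x₀ h).repr v i) • s i, ?_⟩
  have : ∀ (t : Finset (Fin (Module.finrank ℝ F))) (c : Fin (Module.finrank ℝ F) → ℝ),
      (∑ i ∈ t, c i • s i) x₀ = ∑ i ∈ t, c i • s i x₀ := by
    intro t c
    induction t using Finset.induction_on with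
    | empty => simp
    | insert a t ha ih => simp [Finset.sum_insert ha, ih]
  rw [this]
  simp_rw [← hb x₀ h]
  exact (b x₀ h).sum_repr v

/-- A `C^∞(M)`-linear operation with values at `x₀` only depends on the value at `x₀`. -/
theorem tensorial_zero {W : Type*} [AddCommGroup W] [Module ℝ W] (x₀ : M)
    (Φ : Sec n F E → W) (hadd : ∀ s t, Φ (s + t) = Φ s + Φ t)
    (hsmul : ∀ (f : SmoothFn n M) s, Φ (f • s) = f x₀ • Φ s)
    (t : Sec n F E) (ht : t x₀ = 0) : Φ t = 0 := by
  obtain ⟨U, hU, s, b, hb, hg⟩ := exists_frame (n := n) (F := F) (E := E) x₀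
  have h₀ := mem_of_mem_nhds hU
  choose g hg using hg t
  obtain ⟨χ, -, hχ⟩ := (SmoothBumpFunction.nhds_basis_tsupport (I := 𝓡 n) x₀).mem_iff.1 hU
  let f : SmoothFn n M := ⟨χ, χ.contMDiff⟩
  have hsum : ∀ (τ : Finset (Fin (Module.finrank ℝ F))) (x : M),
      (∑ i ∈ τ, (f * g i) • s i) x = ∑ i ∈ τ, (f x * g i x) • s i x := by
    intro τ x
    induction τ using Finset.induction_on with
    | empty => simp
    | insert a t ha ih => simp [Finset.sum_insert ha, ih]
  have hf : f • t = ∑ i, (f * g i) • s i := by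
    ext x
    rw [hsum]
    by_cases hx : x ∈ U
    · have := (b x hx).sum_repr (t x)
      simp_rw [hg _ x hx, hb x hx] at this
      simp_rw [mul_smul, ← Finset.smul_sum, this]
      rfl
    · have hx' : f x = 0 := by
        by_contra hne
        exact hx (hχ (subset_closure hne))
      simp [hx']
  have h0 : Φ 0 = 0 := by simpa using hadd 0 0
  have hΦ : ∀ τ : Finset (Fin (Module.finrank ℝ F)),
      Φ (∑ i ∈ τ, (f * g i) • s i) = ∑ i ∈ τ, (f x₀ * g i x₀) • Φ (s i) := by
    intro τ
    induction τ using Finset.induction_on with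
    | empty => simpa using h0
    | insert a t ha ih => 
      rw [Finset.sum_insert ha, Finset.sum_insert ha, hadd, ih, hsmul]
      rfl
  have h1 : f x₀ = 1 := χ.eq_one
  have := hsmul f t
  rw [h1, one_smul, hf, hΦ] at this
  rw [← this]
  refine Finset.sum_eq_zero fun i _ => ?_
  rw [← hg i x₀ h₀, ht]
  simp

end Tensoriality

/-- The smooth function `π(a)(f)`. -/
def anchorFn (A : CourantAlgebroid n F E) (a : Sec n F E) (f : SmoothFn n M) : SmoothFn n M :=
  ⟨fun x => derivAlong f x (A.anchor x (a x)), by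
    have h1 : ContMDiff (𝓡 n) (𝓡 n).tangent ∞
        (fun x => (⟨x, A.anchor x (a x)⟩ : TangentBundle (𝓡 n) M)) :=
      A.anchor.contMDiff.clm_bundle_apply a.contMDiff
    have h2 : ContMDiff (𝓡 n).tangent 𝓘(ℝ, ℝ).tangent ∞ (tangentMap (𝓡 n) 𝓘(ℝ, ℝ) f) :=
      f.contMDiff.contMDiff_tangentMap (by rfl)
    exact (contMDiff_snd_tangentBundle_modelSpace ℝ 𝓘(ℝ, ℝ)).comp (h2.comp h1)⟩

section Algebra

theorem pairing_mdifferentiableAt (A : CourantAlgebroid n F E) (a b : Sec n F E) (x : M) :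
    MDifferentiableAt (𝓡 n) 𝓘(ℝ, ℝ) (fun y => A.pairing y (a y) (b y)) x := by
  have h : ContMDiff (𝓡 n) ((𝓡 n).prod 𝓘(ℝ, ℝ)) ∞ (fun y => Bundle.TotalSpace.mk' ℝ
      (E := Bundle.Trivial M ℝ) y (A.pairing y (a y) (b y))) :=
    ContMDiff.clm_bundle_apply₂ (F₁ := F) (F₂ := F) A.pairing.contMDiff a.contMDiff b.contMDiff
  have h' : ContMDiff (𝓡 n) 𝓘(ℝ, ℝ) ∞ (fun y => A.pairing y (a y) (b y)) := by
    intro y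
    have := h y
    rw [Bundle.contMDiffAt_totalSpace] at this
    exact this.2
  exact h'.mdifferentiable (by simp) x

theorem derivAlong_add {f g : M → ℝ} {x : M} (hf : MDifferentiableAt (𝓡 n) 𝓘(ℝ, ℝ) f x)
    (hg : MDifferentiableAt (𝓡 n) 𝓘(ℝ, ℝ) g x) (v : TangentSpace (𝓡 n) x) :
    derivAlong (fun y => f y + g y) x v = derivAlong f x v + derivAlong g x v := by
  have := mfderiv_add hf hg
  unfold derivAlong
  exact congrArg (fun L => L v) this

/-- `π(c)⟨a, b⟩ = ⟨[a, b] + [b, a], c⟩`. -/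
theorem pairing_bracket_add (A : CourantAlgebroid n F E) (a b c : Sec n F E) (x : M) :
    A.pairing x (A.bracket a b x + A.bracket b a x) (c x) =
      derivAlong (fun y => A.pairing y (a y) (b y)) x (A.anchor x (c x)) := by
  have h := A.two_bracket_self (a + b) c x
  have ha := A.two_bracket_self a c x
  have hb := A.two_bracket_self b c x
  have e : (fun y => A.pairing y ((a + b) y) ((a + b) y)) =
      fun y => (A.pairing y (a y) (a y) + A.pairing y (b y) (b y)) +
        (A.pairing y (a y) (b y) + A.pairing y (a y) (b y)) := by
    funext y
    simp only [sec_add_apply, map_add, _root_.add_apply]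
    rw [A.pairing_symm y (b y) (a y)]
    ring
  have d1 := A.pairing_mdifferentiableAt a a x
  have d2 := A.pairing_mdifferentiableAt b b x
  have d3 := A.pairing_mdifferentiableAt a b x
  rw [e, derivAlong_add (f := fun y => A.pairing y (a y) (a y) + A.pairing y (b y) (b y))
      (g := fun y => A.pairing y (a y) (b y) + A.pairing y (a y) (b y)) (d1.add d2) (d3.add d3), derivAlong_add d1 d2, derivAlong_add d3 d3,
    ← ha, ← hb] at h
  simp only [map_add, LinearMap.add_apply, sec_add_apply, _root_.add_apply] at h ⊢
  linarith

variable {A : CourantAlgebroid n F E} (V : A.GeneralizedMetric)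

theorem pairing_fiber (ε : ℤˣ) {x : M} {v w : E x} (hv : v ∈ V.fiber ε x)
    (hw : w ∈ V.fiber (-ε) x) : A.pairing x v w = 0 := by
  have hv' : V.G x v = ((ε : ℤ) : ℝ) • v := hv
  have hw' : V.G x w = (((-ε : ℤˣ) : ℤ) : ℝ) • w := hw
  have h := V.symm x v w
  rw [hv', hw'] at h
  rcases Int.units_eq_one_or ε with rfl | rfl <;> simp at h <;> linarith

variable (D : A.GeneralizedConnection)

theorem bracket_smul (a b : Sec n F E) (f : SmoothFn n M) :
    A.bracket a (f • b) = A.anchorFn a f • b + f • A.bracket a b := by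
  ext x
  exact A.bracket_leibniz a b f x

/-- The commutator of the derivations `π(a)` and `π(b)` is `π([a, b])`. -/
theorem anchorFn_comm (a b c : Sec n F E) (f : SmoothFn n M) :
    (A.anchorFn a (A.anchorFn b f) - A.anchorFn b (A.anchorFn a f)
      - A.anchorFn (A.bracket a b) f) • c = 0 := by
  have h := A.jacobi a b (f • c)
  have h' := A.jacobi a b c
  simp only [bracket_smul, map_add] at h
  rw [h'] at h
  simp only [sub_smul]
  have := sub_eq_zero.2 h
  rw [← this]
  module

theorem cov_add_left (a b c : Sec n F E) : D.cov (a + b) c = D.cov a c + D.cov b c := by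
  ext x
  exact map_add (D.toLin c x) (a x) (b x)

theorem cov_smul_left (f : SmoothFn n M) (a c : Sec n F E) : D.cov (f • a) c = f • D.cov a c := by
  ext x
  exact map_smul (D.toLin c x) (f x) (a x)

theorem cov_add (a b c : Sec n F E) : D.cov a (b + c) = D.cov a b + D.cov a c := by
  ext x
  change D.toLin (b + c) x (a x) = _
  rw [map_add]
  rfl

theorem cov_smul (f : SmoothFn n M) (a c : Sec n F E) :
    D.cov a (f • c) = A.anchorFn a f • c + f • D.cov a c := by
  ext x
  exact D.leibniz f c x (a x)

theorem cov_sub_left (a b c : Sec n F E) : D.cov (a - b) c = D.cov a c - D.cov b c := by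
  ext x
  exact map_sub (D.toLin c x) (a x) (b x)

theorem curvature_smul_mid (f : SmoothFn n M) (a b c : Sec n F E) :
    D.curvature a (f • b) c = f • D.curvature a b c := by
  unfold GeneralizedConnection.curvature
  rw [bracket_smul, cov_smul_left, cov_smul_left, cov_smul, cov_add_left, cov_smul_left,
    cov_smul_left]
  module

theorem curvature_smul_right (f : SmoothFn n M) (a b c : Sec n F E) :
    D.curvature a b (f • c) = f • D.curvature a b c := by
  have h := anchorFn_comm (A := A) a b c f
  unfold GeneralizedConnection.curvature
  simp only [cov_smul, cov_add]
  rw [← sub_eq_zero, ← h]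
  module

theorem curvature_add_left (a a' b c : Sec n F E) :
    D.curvature (a + a') b c = D.curvature a b c + D.curvature a' b c := by
  unfold GeneralizedConnection.curvature
  simp only [map_add, LinearMap.add_apply, cov_add, cov_add_left]
  abel

theorem curvature_add_mid (a b b' c : Sec n F E) :
    D.curvature a (b + b') c = D.curvature a b c + D.curvature a b' c := by
  unfold GeneralizedConnection.curvature
  simp only [map_add, cov_add, cov_add_left]
  abel

theorem curvature_add_right (a b c c' : Sec n F E) :
    D.curvature a b (c + c') = D.curvature a b c + D.curvature a b c' := by
  unfold GeneralizedConnection.curvature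
  simp only [cov_add]
  abel

theorem proj_apply (ε : ℤˣ) (e : Sec n F E) (x : M) :
    V.proj ε e x = (1 / 2 : ℝ) • (e x + ((ε : ℤ) : ℝ) • V.G x (e x)) := rfl

theorem proj_mem (ε : ℤˣ) (e : Sec n F E) : V.proj ε e ∈ V.secs ε := by
  intro x
  change V.G x _ = ((ε : ℤ) : ℝ) • _
  rw [proj_apply]
  simp only [map_smul, map_add, V.sq]
  rcases Int.units_eq_one_or ε with rfl | rfl <;> simp <;> module

theorem proj_apply_of_mem (ε : ℤˣ) {e : Sec n F E} {x : M} (h : e x ∈ V.fiber ε x) :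
    V.proj ε e x = e x := by
  rw [proj_apply, show V.G x (e x) = ((ε : ℤ) : ℝ) • e x from h]
  rcases Int.units_eq_one_or ε with rfl | rfl <;> simp <;> module

theorem proj_add (ε : ℤˣ) (a b : Sec n F E) : V.proj ε (a + b) = V.proj ε a + V.proj ε b := by
  ext x
  simp only [proj_apply, sec_add_apply, map_add]
  module

theorem proj_smul (ε : ℤˣ) (f : SmoothFn n M) (a : Sec n F E) :
    V.proj ε (f • a) = f • V.proj ε a := by
  ext x
  simp only [proj_apply, sec_smul_apply, map_smul]
  module

/-- The curvature of a compatible generalized connection takes values in `V_ε`. -/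
theorem curvature_mem (hD : D.IsCompatible V) (ε : ℤˣ) (a b : Sec n F E) {c : Sec n F E}
    (hc : c ∈ V.secs ε) : D.curvature a b c ∈ V.secs ε := by
  have h : ∀ (a c : Sec n F E), c ∈ V.secs ε → D.cov a c ∈ V.secs ε :=
    fun a c hc x => hD ε c hc x (a x)
  exact (V.secs ε).sub_mem ((V.secs ε).sub_mem (h _ _ (h _ _ hc)) (h _ _ (h _ _ hc))) (h _ _ hc)

variable [FiniteDimensional ℝ F] [ContMDiffVectorBundle ∞ F E (𝓡 n)] [T2Space M]

theorem bracket_swap (ε : ℤˣ) {a b : Sec n F E} (ha : a ∈ V.secs ε) (hb : b ∈ V.secs (-ε)) :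
    A.bracket a b = - A.bracket b a := by
  rw [eq_neg_iff_add_eq_zero]
  ext x
  refine A.pairing_nondegenerate x _ fun w => ?_
  obtain ⟨c, rfl⟩ := exists_sec (n := n) (F := F) x w
  have h := A.pairing_bracket_add a b c x
  have e : (fun y => A.pairing y (a y) (b y)) = fun _ => (0 : ℝ) := by
    funext y
    exact pairing_fiber V ε (ha y) (hb y)
  rw [e] at h
  rw [sec_add_apply, h]
  unfold derivAlong
  rw [mfderiv_const]
  rfl

theorem bracket_smul_left (ε : ℤˣ) {a b : Sec n F E} (ha : a ∈ V.secs ε)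
    (hb : b ∈ V.secs (-ε)) (f : SmoothFn n M) :
    A.bracket (f • a) b = f • A.bracket a b - A.anchorFn b f • a := by
  rw [bracket_swap V ε ((V.secs ε).smul_mem f ha) hb, bracket_smul, bracket_swap V ε ha hb]
  rw [smul_neg]
  abel

theorem curvature_smul_left (ε : ℤˣ) {a b : Sec n F E} (ha : a ∈ V.secs ε)
    (hb : b ∈ V.secs (-ε)) (f : SmoothFn n M) (c : Sec n F E) :
    D.curvature (f • a) b c = f • D.curvature a b c := by
  unfold GeneralizedConnection.curvature
  rw [bracket_smul_left V ε ha hb, cov_smul_left, cov_smul_left, cov_smul, cov_sub_left,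
    cov_smul_left, cov_smul_left]
  module

theorem exists_sec_fiber (ε : ℤˣ) (x : M) (v : V.fiber ε x) :
    ∃ d : V.secs ε, (d : Sec n F E) x = v := by
  obtain ⟨s, hs⟩ := exists_sec (n := n) (F := F) x (v : E x)
  exact ⟨⟨V.proj ε s, proj_mem V ε s⟩, by
    rw [← hs]; exact proj_apply_of_mem V ε (hs ▸ v.2)⟩

/-- The value of `R_D^ε(d, b)c` at `x` only depends on `d` through `d(x)`. -/
theorem curvature_congr (ε : ℤˣ) {b : Sec n F E} (hb : b ∈ V.secs (-ε)) (c : Sec n F E) (x : M)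
    {d d' : Sec n F E} (hd : d ∈ V.secs ε) (hd' : d' ∈ V.secs ε) (h : d x = d' x) :
    D.curvature d b c x = D.curvature d' b c x := by
  have key := tensorial_zero (n := n) (F := F) x
    (fun s => D.curvature (V.proj ε s) b c x)
    (fun s t => by simp only [proj_add, curvature_add_left, sec_add_apply])
    (fun f s => by
      simp only [proj_smul]
      rw [curvature_smul_left V D ε (proj_mem V ε s) hb]
      rfl)
    (d - d') (by simp [h])
  have hp : V.proj ε (d - d') = d - d' := by
    ext y
    exact proj_apply_of_mem V ε ((V.secs ε).sub_mem hd hd' y)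
  have hs : D.curvature d b c = D.curvature (d - d') b c + D.curvature d' b c := by
    rw [← curvature_add_left, sub_add_cancel]
  simp only [hp] at key
  rw [hs, sec_add_apply, key, zero_add]

/-- At every point `x`, the map `d ↦ R_D^ε(d, b)c` on `Γ(V_ε)` is induced by a unique endomorphism
of the fibre of `V_ε` at `x`. -/
theorem existsUnique_curvatureEnd (hD : D.IsCompatible V) (ε : ℤˣ) (b : V.secs (-ε))
    (c : V.secs ε) (x : M) :
    ∃! L : V.fiber ε x →ₗ[ℝ] V.fiber ε x, ∀ d : V.secs ε,
      (L ⟨(d : Sec n F E) x, d.2 x⟩ : E x) = D.curvature d b c x := by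
  choose ext hext using exists_sec_fiber V ε x
  have key : ∀ d : V.secs ε, D.curvature (ext ⟨(d : Sec n F E) x, d.2 x⟩) b c x =
      D.curvature d b c x := fun d =>
    curvature_congr V D ε b.2 c x (ext _).2 d.2 (hext _)
  refine ⟨⟨⟨fun v => ⟨D.curvature (ext v) b c x, curvature_mem V D hD ε _ _ c.2 x⟩, ?_⟩, ?_⟩,
    fun d => key d, ?_⟩
  · intro v w
    apply Subtype.ext
    change D.curvature (ext (v + w)) b c x = D.curvature (ext v) b c x + D.curvature (ext w) b c x
    rw [← sec_add_apply, ← curvature_add_left]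
    refine curvature_congr V D ε b.2 c x (ext _).2 ((V.secs ε).add_mem (ext v).2 (ext w).2) ?_
    rw [hext, sec_add_apply, hext, hext]
    rfl
  · intro r v
    apply Subtype.ext
    change D.curvature (ext (r • v)) b c x = r • D.curvature (ext v) b c x
    let f : SmoothFn n M := ⟨fun _ => r, contMDiff_const⟩
    change _ = (f • D.curvature (ext v) b c) x
    rw [← curvature_smul_left V D ε (ext v).2 b.2]
    refine curvature_congr V D ε b.2 c x (ext _).2 ((V.secs ε).smul_mem f (ext v).2) ?_
    rw [hext, sec_smul_apply, hext]
    rfl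
  · intro L hL
    ext v
    have := hL (ext v)
    have e : (⟨(ext v : Sec n F E) x, (ext v).2 x⟩ : V.fiber ε x) = v := Subtype.ext (hext v)
    rw [e] at this
    exact this

end Algebra

section Ricci

variable [FiniteDimensional ℝ F] [ContMDiffVectorBundle ∞ F E (𝓡 n)] [T2Space M]
  {A : CourantAlgebroid n F E} {V : A.GeneralizedMetric} {D : A.GeneralizedConnection}

/-- The endomorphism `d ↦ R_D^ε(d, b)c` of the fibre of `V_ε` at `x`, where `b ∈ Γ(V_{-ε})` and
`c ∈ Γ(V_ε)`. -/
def curvatureEnd (hD : D.IsCompatible V) (ε : ℤˣ) (b : V.secs (-ε)) (c : V.secs ε) (x : M) :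
    V.fiber ε x →ₗ[ℝ] V.fiber ε x :=
  (existsUnique_curvatureEnd V D hD ε b c x).choose

theorem curvatureEnd_apply (hD : D.IsCompatible V) (ε : ℤˣ) (b : V.secs (-ε)) (c : V.secs ε)
    (x : M) (d : V.secs ε) :
    (curvatureEnd hD ε b c x ⟨(d : Sec n F E) x, d.2 x⟩ : E x) = D.curvature d b c x :=
  (existsUnique_curvatureEnd V D hD ε b c x).choose_spec.1 d

theorem curvatureEnd_unique (hD : D.IsCompatible V) (ε : ℤˣ) (b : V.secs (-ε)) (c : V.secs ε)
    (x : M) (L : V.fiber ε x →ₗ[ℝ] V.fiber ε x)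
    (hL : ∀ d : V.secs ε, (L ⟨(d : Sec n F E) x, d.2 x⟩ : E x) = D.curvature d b c x) :
    curvatureEnd hD ε b c x = L :=
  ((existsUnique_curvatureEnd V D hD ε b c x).choose_spec.2 L hL).symm

/-- The projection of the fibre `E x` onto the fibre of `V_ε`. -/
def fiberProj (V : A.GeneralizedMetric) (ε : ℤˣ) (x : M) : E x →ₗ[ℝ] V.fiber ε x where
  toFun v := ⟨(1 / 2 : ℝ) • (v + ((ε : ℤ) : ℝ) • V.G x v), by
    obtain ⟨s, rfl⟩ := exists_sec (n := n) (F := F) x v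
    exact proj_mem V ε s x⟩
  map_add' v w := by
    apply Subtype.ext
    simp only [map_add, Submodule.coe_add]
    module
  map_smul' r v := by
    apply Subtype.ext
    simp only [map_smul, Submodule.coe_smul, RingHom.id_apply]
    module

theorem trace_curvatureEnd_contMDiff (hD : D.IsCompatible V) (ε : ℤˣ) (b : V.secs (-ε))
    (c : V.secs ε) :
    ContMDiff (𝓡 n) 𝓘(ℝ, ℝ) ∞
      (fun x => LinearMap.trace ℝ (V.fiber ε x) (curvatureEnd hD ε b c x)) := by
  intro x₀
  obtain ⟨U, hU, s, β, hβ, hg⟩ := exists_frame (n := n) (F := F) (E := E) x₀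
  choose g hg using fun i => hg (D.curvature (V.proj ε (s i)) b c) i
  have hsm : ContMDiffAt (𝓡 n) 𝓘(ℝ, ℝ) ∞ (fun x => ∑ i, g i x) x₀ :=
    contMDiffAt_finsetSum fun i _ => (g i).contMDiff x₀
  refine hsm.congr_of_eventuallyEq ?_
  filter_upwards [hU] with x hx
  have : Module.Finite ℝ (E x) := Module.Finite.of_basis (β x hx)
  have h1 : LinearMap.trace ℝ (V.fiber ε x) (curvatureEnd hD ε b c x) =
      LinearMap.trace ℝ (E x)
        ((V.fiber ε x).subtype ∘ₗ (curvatureEnd hD ε b c x ∘ₗ fiberProj V ε x)) := by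
    rw [LinearMap.trace_comp_comm', LinearMap.comp_assoc]
    congr 1
    ext v
    obtain ⟨d, hd⟩ := exists_sec_fiber (n := n) (F := F) V ε x v
    have : fiberProj V ε x v = v := by
      apply Subtype.ext
      change (1 / 2 : ℝ) • ((v : E x) + ((ε : ℤ) : ℝ) • V.G x v) = v
      rw [← hd, ← proj_apply]
      exact proj_apply_of_mem V ε (d.2 x)
    simp [this]
  rw [h1, LinearMap.trace_eq_matrix_trace ℝ (β x hx), Matrix.trace]
  refine Finset.sum_congr rfl fun i _ => ?_
  rw [Matrix.diag_apply, LinearMap.toMatrix_apply, hβ, ← hg i x hx]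
  congr 2
  exact curvatureEnd_apply hD ε b c x ⟨V.proj ε (s i), proj_mem V ε (s i)⟩

/-- The Ricci tensor `Ric_D^ε ∈ Γ(V_{-ε}^* ⊗ V_ε^*)` of a compatible generalized connection, for a
sign `ε`, as a `C^∞(M)`-bilinear form: `Ric_D^ε(b, c) = tr (d ↦ R_D^ε(d, b)c)`, the trace being
taken over `V_ε`. -/
def ricci (hD : D.IsCompatible V) (ε : ℤˣ) :
    V.secs (-ε) →ₗ[SmoothFn n M] V.secs ε →ₗ[SmoothFn n M] SmoothFn n M :=
  LinearMap.mk₂ (SmoothFn n M)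
    (fun b c => ⟨fun x => LinearMap.trace ℝ (V.fiber ε x) (curvatureEnd hD ε b c x),
      trace_curvatureEnd_contMDiff hD ε b c⟩)
    (fun b b' c => by
      ext x
      change LinearMap.trace ℝ _ _ = LinearMap.trace ℝ _ _ + LinearMap.trace ℝ _ _
      rw [← map_add]
      congr 1
      refine curvatureEnd_unique hD ε _ _ x _ fun d => ?_
      rw [LinearMap.add_apply, Submodule.coe_add, curvatureEnd_apply, curvatureEnd_apply,
        Submodule.coe_add, curvature_add_mid, sec_add_apply])
    (fun f b c => by
      ext x
      change LinearMap.trace ℝ _ _ = f x • LinearMap.trace ℝ _ _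
      rw [← map_smul]
      congr 1
      refine curvatureEnd_unique hD ε _ _ x _ fun d => ?_
      rw [LinearMap.smul_apply, Submodule.coe_smul, curvatureEnd_apply,
        Submodule.coe_smul, curvature_smul_mid, sec_smul_apply])
    (fun b c c' => by
      ext x
      change LinearMap.trace ℝ _ _ = LinearMap.trace ℝ _ _ + LinearMap.trace ℝ _ _
      rw [← map_add]
      congr 1
      refine curvatureEnd_unique hD ε _ _ x _ fun d => ?_
      rw [LinearMap.add_apply, Submodule.coe_add, curvatureEnd_apply, curvatureEnd_apply,
        Submodule.coe_add, curvature_add_right, sec_add_apply])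
    (fun f b c => by
      ext x
      change LinearMap.trace ℝ _ _ = f x • LinearMap.trace ℝ _ _
      rw [← map_smul]
      congr 1
      refine curvatureEnd_unique hD ε _ _ x _ fun d => ?_
      rw [LinearMap.smul_apply, Submodule.coe_smul, curvatureEnd_apply,
        Submodule.coe_smul, curvature_smul_right, sec_smul_apply])

end Ricci

/-- `D` belongs to `𝒟(V_+, div)`: it is compatible with the generalized metric, torsion-free, and
its divergence is `div`. -/
structure IsLeviCivita {A : CourantAlgebroid n F E} (V : A.GeneralizedMetric)
    (div : A.DivergenceOperator) (D : A.GeneralizedConnection) : Prop where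
  compatible : D.IsCompatible V
  torsion_eq_zero : D.torsion = 0
  divergence_eq : ∀ e x, D.divergence e x = div.toLin e x

end CourantAlgebroid

end GenGeom

end

open scoped Manifold ContDiff Topology Bundle

noncomputable section

namespace GenGeom

namespace CourantAlgebroid

variable {n : ℕ} {M : Type*} [TopologicalSpace M]
    [ChartedSpace (EuclideanSpace ℝ (Fin n)) M] [IsManifold (𝓡 n) ∞ M]
    {F : Type*} [NormedAddCommGroup F] [NormedSpace ℝ F]
    {E : M → Type*} [TopologicalSpace (Bundle.TotalSpace F E)]
    [∀ x, AddCommGroup (E x)] [∀ x, Module ℝ (E x)] [∀ x, TopologicalSpace (E x)]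
    [∀ x, IsTopologicalAddGroup (E x)] [∀ x, ContinuousSMul ℝ (E x)]
    [FiberBundle F E] [VectorBundle ℝ F E]
    {A : CourantAlgebroid n F E} {V : A.GeneralizedMetric}

/-! Fix a sign `ε`; both Ricci tensors come from the same argument. Let `b ∈ Γ(V_{-ε})`, `c, d ∈
Γ(V_ε)`, and let `D`, `D'` be compatible with torsion of pure type. The vanishing of the mixed
torsion makes `D_b c` the `V_ε`-component of `[b, c]`, so that mixed derivatives do not depend on
the connection (`cov_eq_cov_of_isPureType`). Hence for `e ∈ Γ(V_ε)` the endomorphism `Φ_e = D'e -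
De` of `E` kills `V_{-ε}`, and equality of the divergences says precisely that `tr Φ_e = 0`.

Replacing mixed derivatives by their common value gives (`curvature_sub_curvature`) `R_{D'}(d, b)c -
R_D(d, b)c = Φ_{D_b c}(d) - [D_b, Φ_c](d)`. In the trace over `d` the first term contributes `tr
Φ_{D_b c} = 0`, since `D_b c` is again in `Γ(V_ε)`. The second contributes `tr [D_b, Φ_c] = π(b)(tr
Φ_c) = 0` by `trace_commutator`: covariant derivation commutes with the trace. So the Ricci tensors
agree.

Only purity of the two torsions enters; zero torsion is a special case. Part (ii) follows, since
nonemptiness supplies a connection whose Ricci tensors are the common value. -/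

/-- The action of a smooth field of endomorphisms on sections. -/
def endAction (T : Sec n (F →L[ℝ] F) (fun x : M => E x →L[ℝ] E x)) (s : Sec n F E) : Sec n F E :=
  ⟨fun x => T x (s x), T.contMDiff.clm_bundle_apply s.contMDiff⟩

/-! ### Derivatives and connections on finite sums -/

theorem sec_sum_smul_apply {ι : Type*} (τ : Finset ι) (f : ι → SmoothFn n M) (s : ι → Sec n F E)
    (x : M) : (∑ i ∈ τ, f i • s i) x = ∑ i ∈ τ, f i x • s i x := by
  classical
  induction τ using Finset.induction_on with
  | empty => simp
  | insert a t ha ih => simp [Finset.sum_insert ha, ih]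

theorem derivAlong_eventually_const {f : M → ℝ} {x : M} {r : ℝ} (h : ∀ᶠ y in 𝓝 x, f y = r)
    (v : TangentSpace (𝓡 n) x) : derivAlong f x v = 0 := by
  unfold derivAlong
  have h' : f =ᶠ[𝓝 x] fun _ => r := h
  rw [h'.mfderiv_eq, mfderiv_const]
  rfl

theorem derivAlong_congr {f g : M → ℝ} {x : M} (h : f =ᶠ[𝓝 x] g)
    (v : TangentSpace (𝓡 n) x) : derivAlong f x v = derivAlong g x v := by
  unfold derivAlong
  rw [h.mfderiv_eq]
  rfl

theorem derivAlong_sum {ι : Type*} (τ : Finset ι) (f : ι → SmoothFn n M) (x : M)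
    (v : TangentSpace (𝓡 n) x) :
    derivAlong (fun y => ∑ i ∈ τ, f i y) x v = ∑ i ∈ τ, derivAlong (f i) x v := by
  classical
  induction τ using Finset.induction_on with
  | empty =>
    simp only [Finset.sum_empty]
    exact derivAlong_eventually_const (r := 0) (Filter.Eventually.of_forall fun _ => rfl) v
  | insert a t ha ih =>
    simp only [Finset.sum_insert ha]
    rw [derivAlong_add, ih]
    · exact (f a).contMDiff.mdifferentiable (by simp) x
    · have h : ContMDiff (𝓡 n) 𝓘(ℝ, ℝ) ∞ (fun y => ∑ i ∈ t, f i y) :=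
        contMDiff_finsetSum fun i _ => (f i).contMDiff
      exact h.mdifferentiable (by simp) x

theorem toLin_sum_smul (D : A.GeneralizedConnection) {ι : Type*} (τ : Finset ι)
    (f : ι → SmoothFn n M) (s : ι → Sec n F E) (x : M) (v : E x) :
    D.toLin (∑ i ∈ τ, f i • s i) x v =
      ∑ i ∈ τ, (derivAlong (f i) x (A.anchor x v) • s i x + f i x • D.toLin (s i) x v) := by
  classical
  induction τ using Finset.induction_on with
  | empty => simp
  | insert a t ha ih =>
    rw [Finset.sum_insert ha, Finset.sum_insert ha, map_add, ← ih, ← D.leibniz]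
    rfl

/-! ### Locality of generalized connections -/

section Local

variable [T2Space M]

/-- A generalized connection is a local operator. -/
theorem toLin_congr_of_eventuallyEq (D : A.GeneralizedConnection) {s t : Sec n F E} {x : M}
    (h : ∀ᶠ y in 𝓝 x, s y = t y) (v : E x) : D.toLin s x v = D.toLin t x v := by
  -- Cut off inside the set where `s = t`: then `ψ s = ψ t` globally. Since `ψ = 1` near `x`, its
  -- derivative vanishes there and the Leibniz rule returns `D s` and `D t` at `x`.
  obtain ⟨ψ, -, hψ⟩ := (SmoothBumpFunction.nhds_basis_tsupport (I := 𝓡 n) x).mem_iff.1 h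
  let f : SmoothFn n M := ⟨ψ, ψ.contMDiff⟩
  have hf : f • s = f • t := by
    ext y
    by_cases hy : ψ y = 0
    · have : f y = 0 := hy
      simp [this]
    · have : s y = t y := hψ (subset_closure hy)
      simp [this]
  have hone : f x = 1 := ψ.eq_one
  have hd : derivAlong f x (A.anchor x v) = 0 :=
    derivAlong_eventually_const (r := 1) ψ.eventuallyEq_one _
  have hs := D.leibniz f s x v
  have ht := D.leibniz f t x v
  rw [hone, hd, zero_smul, zero_add, one_smul] at hs ht
  rw [← hs, ← ht, hf]

end Local

/-! ### Trace of the commutator of a connection with an endomorphism field -/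

section Trace

variable [FiniteDimensional ℝ F] [ContMDiffVectorBundle ∞ F E (𝓡 n)] [T2Space M]

/-- The trace of the commutator of `D_b` with a field of endomorphisms `T` is `π(b)(tr T)`. -/
theorem trace_commutator (D : A.GeneralizedConnection) (b : Sec n F E)
    (T : Sec n (F →L[ℝ] F) (fun x : M => E x →L[ℝ] E x)) (x : M) (K : E x →ₗ[ℝ] E x)
    (hK : ∀ s : Sec n F E, K (s x) = D.cov b (endAction T s) x - T x (D.cov b s x)) :
    LinearMap.trace ℝ (E x) K =
      derivAlong (fun y => LinearMap.trace ℝ (E y) (T y : E y →ₗ[ℝ] E y)) x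
        (A.anchor x (b x)) := by
  obtain ⟨U, hU, s, β, hβ, hg⟩ := exists_frame (n := n) (F := F) (E := E) x
  have hx := mem_of_mem_nhds hU
  -- Matrices in the frame: on `U`, `T s_j = ∑ i, φ j i • s_i` and `D_b s_j = ∑ i, ξ j i • s_i`,
  -- with coefficients that are global smooth functions.
  choose φ hφ using fun j => hg (endAction T (s j))
  choose ξ hξ using fun j => hg (D.cov b (s j))
  have expand : ∀ (t : Sec n F E) (g : Fin (Module.finrank ℝ F) → SmoothFn n M)
      (_ : ∀ i y hy, (β y hy).repr (t y) i = g i y), ∀ y ∈ U, t y = ∑ i, g i y • s i y := by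
    intro t g h y hy
    have := (β y hy).sum_repr (t y)
    simp_rw [h _ y hy, hβ y hy] at this
    exact this.symm
  have htr : ∀ y ∈ U, LinearMap.trace ℝ (E y) (T y : E y →ₗ[ℝ] E y) = ∑ j, φ j j y := by
    intro y hy
    rw [LinearMap.trace_eq_matrix_trace ℝ (β y hy), Matrix.trace]
    refine Finset.sum_congr rfl fun j _ => ?_
    rw [Matrix.diag_apply, LinearMap.toMatrix_apply, hβ, ← hφ j j y hy]
    rfl
  rw [derivAlong_congr (Filter.mem_of_superset hU htr), derivAlong_sum,
    LinearMap.trace_eq_matrix_trace ℝ (β x hx), Matrix.trace]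
  have hrepr : ∀ i j, (β x hx).repr (s i x) j = if i = j then 1 else 0 := by
    intro i j
    rw [← hβ x hx i, Module.Basis.repr_self, Finsupp.single_apply]
  -- Diagonal entries of `[D_b, T]`: the derivative of the matrix of `T`, plus a commutator of the
  -- matrices `φ` and `ξ`, which has trace zero.
  have hentry : ∀ j, (LinearMap.toMatrix (β x hx) (β x hx) K).diag j =
      derivAlong (φ j j) x (A.anchor x (b x)) +
        (∑ i, φ j i x * ξ i j x - ∑ i, ξ j i x * φ i j x) := by
    intro j
    have h1 : D.cov b (endAction T (s j)) x =
        ∑ i, (derivAlong (φ j i) x (A.anchor x (b x)) • s i x + φ j i x • D.cov b (s i) x) := by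
      refine Eq.trans ?_ (toLin_sum_smul D Finset.univ (φ j) s x (b x))
      -- The frame expansion of `T s_j` holds only on `U`, so locality of `D` is needed before
      -- differentiating it.
      refine toLin_congr_of_eventuallyEq D ?_ (b x)
      filter_upwards [hU] with y hy
      rw [sec_sum_smul_apply]
      exact expand _ (φ j) (hφ j) y hy
    have h2 : T x (D.cov b (s j) x) = ∑ i, ξ j i x • endAction T (s i) x := by
      rw [expand _ (ξ j) (hξ j) x hx, map_sum]
      exact Finset.sum_congr rfl fun i _ => map_smul _ _ _
    rw [Matrix.diag_apply, LinearMap.toMatrix_apply, hβ, hK, h1, h2]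
    simp only [map_sub, map_sum, map_add, map_smul, Finsupp.sub_apply, Finsupp.add_apply,
      Finsupp.smul_apply, Finsupp.finsetSum_apply, hrepr, hφ _ _ x hx, hξ _ _ x hx, smul_eq_mul,
      Finset.sum_add_distrib]
    simp [add_sub_assoc]
  simp_rw [hentry, Finset.sum_add_distrib, Finset.sum_sub_distrib]
  -- Exchanging the indices in one double sum makes the two cancel.
  rw [Finset.sum_comm (f := fun j i => φ j i x * ξ i j x)]
  simp [mul_comm]

end Trace

/-! ### The splitting into `V_ε` and `V_{-ε}`, and torsion of pure type -/

theorem units_eq_neg_or (ε δ : ℤˣ) : ε = δ ∨ ε = -δ := by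
  rcases Int.units_eq_one_or ε with rfl | rfl <;> rcases Int.units_eq_one_or δ with rfl | rfl <;>
    simp

theorem proj_of_mem (V : A.GeneralizedMetric) (ε : ℤˣ) {e : Sec n F E} (he : e ∈ V.secs ε) :
    V.proj ε e = e := by
  ext x
  exact proj_apply_of_mem V ε (he x)

theorem proj_add_proj_neg (V : A.GeneralizedMetric) (ε : ℤˣ) (e : Sec n F E) :
    V.proj ε e + V.proj (-ε) e = e := by
  ext x
  rw [sec_add_apply, proj_apply, proj_apply]
  push_cast
  module

theorem proj_eq_zero_of_mem_neg (V : A.GeneralizedMetric) (ε : ℤˣ) {e : Sec n F E}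
    (he : e ∈ V.secs (-ε)) : V.proj ε e = 0 := by
  have h := proj_add_proj_neg V ε e
  rw [proj_of_mem V (-ε) he] at h
  simpa using h

theorem eq_zero_of_mem_of_mem_neg (V : A.GeneralizedMetric) (ε : ℤˣ) {e : Sec n F E}
    (he : e ∈ V.secs ε) (he' : e ∈ V.secs (-ε)) : e = 0 := by
  rw [← proj_of_mem V ε he, proj_eq_zero_of_mem_neg V ε he']

theorem cov_mem {D : A.GeneralizedConnection} (hD : D.IsCompatible V) {ε : ℤˣ} (a : Sec n F E)
    {c : Sec n F E} (hc : c ∈ V.secs ε) : D.cov a c ∈ V.secs ε :=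
  fun x => hD ε c hc x (a x)

theorem cov_sub (D : A.GeneralizedConnection) (a b c : Sec n F E) :
    D.cov a (b - c) = D.cov a b - D.cov a c := by
  ext x
  change D.toLin (b - c) x (a x) = _
  rw [map_sub]
  rfl

theorem torsion_zero_left (D : A.GeneralizedConnection) (b c : Sec n F E) :
    D.torsion 0 b c = 0 := by
  have h1 : D.cov 0 b = 0 := by simpa using cov_sub_left D 0 0 b
  have h2 : ∀ a, D.cov a 0 = 0 := fun a => by simpa using cov_sub D a 0 0
  funext x
  simp [GeneralizedConnection.torsion, h1, h2]

theorem torsion_zero_mid (D : A.GeneralizedConnection) (a c : Sec n F E) :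
    D.torsion a 0 c = 0 := by
  have h1 : D.cov 0 a = 0 := by simpa using cov_sub_left D 0 0 a
  have h2 : ∀ a, D.cov a 0 = 0 := fun a => by simpa using cov_sub D a 0 0
  funext x
  simp [GeneralizedConnection.torsion, h1, h2]

/-- Each pure component sees `b` and `c` through the same projection, which annihilates one of them.
-/
theorem torsion_eq_zero_of_isPureType {D : A.GeneralizedConnection}
    (hT : V.IsPureType D.torsion) (ε : ℤˣ) {b c : Sec n F E} (hb : b ∈ V.secs (-ε))
    (hc : c ∈ V.secs ε) (w : Sec n F E) : D.torsion b c w = 0 := by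
  have h : ∀ δ : ℤˣ, D.torsion (V.proj δ b) (V.proj δ c) (V.proj δ w) = 0 := by
    intro δ
    rcases units_eq_neg_or δ ε with rfl | rfl
    · rw [proj_eq_zero_of_mem_neg V δ hb, torsion_zero_left]
    · rw [proj_eq_zero_of_mem_neg V (-ε) (e := c) (by rwa [neg_neg]), torsion_zero_mid]
  rw [hT b c w, h, h, add_zero]

/-! ### Mixed derivatives are determined by the bracket -/

section Mixed

variable [FiniteDimensional ℝ F] [ContMDiffVectorBundle ∞ F E (𝓡 n)] [T2Space M]

/-- `V_{-ε}` is the orthogonal complement of `V_ε`. -/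
theorem mem_secs_neg_of_pairing_eq_zero (V : A.GeneralizedMetric) (ε : ℤˣ) {u : Sec n F E}
    (h : ∀ w ∈ V.secs ε, ∀ x, A.pairing x (u x) (w x) = 0) : u ∈ V.secs (-ε) := by
  intro x
  -- The left side is `2ε` times the `V_ε`-component of `u`. Symmetry of `G` moves that projection
  -- onto the test vector, where the hypothesis applies.
  have key : V.G x (u x) + ((ε : ℤ) : ℝ) • u x = 0 := by
    refine A.pairing_nondegenerate x _ fun w => ?_
    obtain ⟨s, rfl⟩ := exists_sec (n := n) (F := F) x w
    have hs := h _ (proj_mem V ε s) x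
    rw [proj_apply] at hs
    simp only [map_add, map_smul, _root_.add_apply, smul_eq_mul, FunLike.coe_smul, Pi.smul_apply]
      at hs ⊢
    rw [V.symm]
    rcases Int.units_eq_one_or ε with rfl | rfl <;> simp at hs ⊢ <;> linarith
  change V.G x (u x) = _
  rw [eq_neg_of_add_eq_zero_left key]
  push_cast
  rw [neg_smul]

/-- If the torsion is of pure type, `D_b c` is the `V_ε`-component of `[b, c]`, for `b` in
`Γ(V_{-ε})` and `c` in `Γ(V_ε)`. -/
theorem bracket_sub_cov_mem {D : A.GeneralizedConnection} (hD : D.IsCompatible V)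
    (hT : V.IsPureType D.torsion) (ε : ℤˣ) {b c : Sec n F E} (hb : b ∈ V.secs (-ε))
    (hc : c ∈ V.secs ε) : A.bracket b c - D.cov b c ∈ V.secs (-ε) := by
  refine mem_secs_neg_of_pairing_eq_zero V ε fun w hw x => ?_
  have h := congrFun (torsion_eq_zero_of_isPureType hT ε hb hc w) x
  -- In `T_D(b, c, w)` with `w ∈ Γ(V_ε)`, the terms with `D_c b` and `D_w b` drop out: both are in
  -- `V_{-ε}` by compatibility, hence orthogonal to `w` and `c`. What remains is `⟨D_b c - [b, c],
  -- w⟩`.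
  have h1 : A.pairing x (D.cov c b x) (w x) = 0 := by
    rw [A.pairing_symm]
    exact pairing_fiber V ε (hw x) (cov_mem hD c hb x)
  have h2 : A.pairing x (D.cov w b x) (c x) = 0 := by
    rw [A.pairing_symm]
    exact pairing_fiber V ε (hc x) (cov_mem hD w hb x)
  simp only [GeneralizedConnection.torsion, sec_sub_apply, map_sub, _root_.sub_apply, h1, h2,
    Pi.zero_apply] at h ⊢
  linarith

/-- Both derivatives lie in `V_ε` and differ from the same `[b, c]` by elements of `V_{-ε}`, so
their difference lies in `V_ε ∩ V_{-ε} = 0`. -/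
theorem cov_eq_cov_of_isPureType {D D' : A.GeneralizedConnection} (hD : D.IsCompatible V)
    (hD' : D'.IsCompatible V) (hT : V.IsPureType D.torsion) (hT' : V.IsPureType D'.torsion)
    (ε : ℤˣ) {b c : Sec n F E} (hb : b ∈ V.secs (-ε)) (hc : c ∈ V.secs ε) :
    D'.cov b c = D.cov b c := by
  rw [← sub_eq_zero]
  refine eq_zero_of_mem_of_mem_neg V ε ((V.secs ε).sub_mem (cov_mem hD' b hc) (cov_mem hD b hc)) ?_
  have := (V.secs (-ε)).sub_mem (bracket_sub_cov_mem hD hT ε hb hc)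
    (bracket_sub_cov_mem hD' hT' ε hb hc)
  simpa using this

/-! ### Comparison of curvatures and of Ricci tensors -/

/-- For `d ∈ Γ(V_ε)`, the curvatures of two connections differ by a divergence-like term and a
commutator with `D_b`. -/
theorem curvature_sub_curvature {D D' : A.GeneralizedConnection} (hD : D.IsCompatible V)
    (hD' : D'.IsCompatible V) (hT : V.IsPureType D.torsion) (hT' : V.IsPureType D'.torsion)
    (ε : ℤˣ) {b c d : Sec n F E} (hb : b ∈ V.secs (-ε)) (hc : c ∈ V.secs ε)
    (hd : d ∈ V.secs ε) :
    D'.curvature d b c - D.curvature d b c =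
      (endAction (D'.toLin (D.cov b c) - D.toLin (D.cov b c)) d) -
        (D.cov b (endAction (D'.toLin c - D.toLin c) d) -
          endAction (D'.toLin c - D.toLin c) (D.cov b d)) := by
  have hE : ∀ e s, endAction (D'.toLin e - D.toLin e) s = D'.cov s e - D.cov s e :=
    fun _ _ => rfl
  have hmix : ∀ {u : Sec n F E}, u ∈ V.secs ε → D'.cov b u = D.cov b u :=
    fun hu => cov_eq_cov_of_isPureType hD hD' hT hT' ε hb hu
  -- `[b, d] - D_b d` lies in `V_{-ε}`, where `D'` and `D` agree on `c`. So `D_b d` may replace `[b,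
  -- d]` in the difference of the bracket terms, which yields the missing half of the commutator.
  have hneg := cov_eq_cov_of_isPureType hD hD' hT hT' ε (bracket_sub_cov_mem hD hT ε hb hd) hc
  have hbr : A.bracket d b = -A.bracket b d := bracket_swap V ε hd hb
  have hn : ∀ (D : A.GeneralizedConnection) (u : Sec n F E), D.cov (-u) c = -D.cov u c :=
    fun D u => by ext x; exact map_neg (D.toLin c x) (u x)
  rw [cov_sub_left, cov_sub_left] at hneg
  unfold GeneralizedConnection.curvature
  rw [hE, hE, hE, cov_sub, hmix hc, hmix (cov_mem hD' d hc), hbr, hn, hn]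
  have : D'.cov (A.bracket b d) c - D.cov (A.bracket b d) c =
      D'.cov (D.cov b d) c - D.cov (D.cov b d) c := by
    rw [← sub_eq_zero] at hneg ⊢
    rw [← hneg]
    abel
  rw [← this]
  abel

theorem fiberProj_apply_sec (ε : ℤˣ) (x : M) (s : Sec n F E) :
    fiberProj V ε x (s x) = ⟨V.proj ε s x, proj_mem V ε s x⟩ := rfl

/-- Cyclicity of the trace, with projection after inclusion being the identity of `V_ε`. This turns
traces over `V_ε` into traces over `E`, where `trace_commutator` and the divergence live. -/
theorem trace_comp_fiberProj (ε : ℤˣ) (x : M) (L : V.fiber ε x →ₗ[ℝ] V.fiber ε x) :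
    LinearMap.trace ℝ (E x) ((V.fiber ε x).subtype ∘ₗ (L ∘ₗ fiberProj V ε x)) =
      LinearMap.trace ℝ (V.fiber ε x) L := by
  have hx : x ∈ (trivializationAt F E x).baseSet := FiberBundle.mem_baseSet_trivializationAt F E x
  have : Module.Finite ℝ (E x) :=
    Module.Finite.of_basis ((trivializationAt F E x).basisAt (Module.finBasis ℝ F) hx)
  rw [LinearMap.trace_comp_comm', LinearMap.comp_assoc]
  congr 1
  ext v
  obtain ⟨d, hd⟩ := exists_sec_fiber (n := n) (F := F) V ε x v
  have : fiberProj V ε x v = v := by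
    apply Subtype.ext
    rw [← hd, fiberProj_apply_sec]
    exact proj_apply_of_mem V ε (d.2 x)
  simp [this]

/-- The Ricci tensors only depend on the generalized metric and the divergence, among compatible
connections with torsion of pure type. -/
theorem ricci_eq_of_divergence_eq {D D' : A.GeneralizedConnection} (hD : D.IsCompatible V)
    (hD' : D'.IsCompatible V) (hT : V.IsPureType D.torsion) (hT' : V.IsPureType D'.torsion)
    (hdiv : D.divergence = D'.divergence) (ε : ℤˣ) : ricci hD ε = ricci hD' ε := by
  ext b c x
  change LinearMap.trace ℝ (V.fiber ε x) (curvatureEnd hD ε b c x) =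
    LinearMap.trace ℝ (V.fiber ε x) (curvatureEnd hD' ε b c x)
  have htr : ∀ (e : Sec n F E) (y : M), LinearMap.trace ℝ (E y)
      (((D'.toLin e - D.toLin e : Sec n (F →L[ℝ] F) (fun x : M => E x →L[ℝ] E x)) y :
        E y →L[ℝ] E y) : E y →ₗ[ℝ] E y) = 0 := by
    intro e y
    have h := congrFun (congrFun hdiv e) y
    unfold GeneralizedConnection.divergence at h
    have h' : (((D'.toLin e - D.toLin e : Sec n (F →L[ℝ] F) (fun x : M => E x →L[ℝ] E x)) y :
        E y →L[ℝ] E y) : E y →ₗ[ℝ] E y) =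
        (D'.toLin e y : E y →ₗ[ℝ] E y) - (D.toLin e y : E y →ₗ[ℝ] E y) := rfl
    rw [h', map_sub, h, sub_self]
  set Φ : Sec n (F →L[ℝ] F) (fun x : M => E x →L[ℝ] E x) :=
    D'.toLin (c : Sec n F E) - D.toLin (c : Sec n F E) with hΦ
  set Ψ : Sec n (F →L[ℝ] F) (fun x : M => E x →L[ℝ] E x) :=
    D'.toLin (D.cov b c) - D.toLin (D.cov b c) with hΨ
  set L := curvatureEnd hD' ε b c x - curvatureEnd hD ε b c x with hL
  suffices LinearMap.trace ℝ (V.fiber ε x) L = 0 by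
    rw [hL, map_sub, sub_eq_zero] at this
    exact this.symm
  -- At `t ∈ Γ(V_{-ε})` this is a difference of mixed derivatives.
  have hvanish : ∀ (e : V.secs ε) (t : Sec n F E), t ∈ V.secs (-ε) →
      endAction (D'.toLin (e : Sec n F E) - D.toLin (e : Sec n F E)) t = 0 := fun e t ht =>
    sub_eq_zero.2 (cov_eq_cov_of_isPureType hD hD' hT hT' ε ht e.2)
  set P := (V.fiber ε x).subtype ∘ₗ (L ∘ₗ fiberProj V ε x) with hP
  -- `P` extends the curvature difference by zero to `V_{-ε}`. The formula holds for every section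
  -- `s` of `E`, because the right side also kills `V_{-ε}`: so do `Φ` and `Ψ`, and `D_b` preserves
  -- `Γ(V_{-ε})`.
  have hPs : ∀ s : Sec n F E, P (s x) =
      Ψ x (s x) - (D.cov b (endAction Φ s) x - Φ x (D.cov b s x)) := by
    intro s
    have h1 : P (s x) = (D'.curvature (V.proj ε s) b c - D.curvature (V.proj ε s) b c) x := by
      rw [sec_sub_apply]
      have e' := curvatureEnd_apply hD' ε b c x ⟨V.proj ε s, proj_mem V ε s⟩
      have e := curvatureEnd_apply hD ε b c x ⟨V.proj ε s, proj_mem V ε s⟩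
      rw [← e, ← e']
      rfl
    rw [h1, curvature_sub_curvature hD hD' hT hT' ε b.2 c.2 (proj_mem V ε s)]
    have hadd : ∀ (T : Sec n (F →L[ℝ] F) (fun x : M => E x →L[ℝ] E x)) (s t : Sec n F E),
        endAction T (s + t) = endAction T s + endAction T t := fun T s t => by
      ext y
      exact map_add (T y) (s y) (t y)
    have hm := proj_mem V (-ε) s
    have hs := proj_add_proj_neg V ε s
    have hΨs : endAction Ψ s = endAction Ψ (V.proj ε s) := by
      conv_lhs => rw [← hs, hadd, hvanish ⟨D.cov b c, cov_mem hD b c.2⟩ _ hm, add_zero]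
    have hΦs : endAction Φ s = endAction Φ (V.proj ε s) := by
      conv_lhs => rw [← hs, hadd, hvanish c _ hm, add_zero]
    have hΦD : endAction Φ (D.cov b s) = endAction Φ (D.cov b (V.proj ε s)) := by
      conv_lhs => rw [← hs, cov_add, hadd, hvanish c _ (cov_mem hD b hm), add_zero]
    rw [← hΦ, ← hΨ, ← hΨs, ← hΦs, ← hΦD]
    rfl
  -- By `hPs`, `Ψ - P` is the commutator `[D_b, Φ]`, already given as a fibrewise endomorphism. As
  -- `Ψ` and `Φ` are traceless, this forces `tr P = 0`.
  have hK := trace_commutator D b Φ x ((Ψ x : E x →ₗ[ℝ] E x) - P) fun s => by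
    rw [LinearMap.sub_apply, hPs]
    simp
  rw [map_sub, htr, zero_sub,
    derivAlong_eventually_const (r := 0) (Filter.Eventually.of_forall fun y => htr _ y),
    neg_eq_zero, hP, trace_comp_fiberProj] at hK
  exact hK

theorem isPureType_of_torsion_eq_zero {D : A.GeneralizedConnection} (h : D.torsion = 0) :
    V.IsPureType D.torsion := by
  intro a b c
  simp [h]

theorem IsLeviCivita.ricci_eq {div : A.DivergenceOperator} {D D' : A.GeneralizedConnection}
    (hD : IsLeviCivita V div D) (hD' : IsLeviCivita V div D') (ε : ℤˣ) :
    ricci hD.compatible ε = ricci hD'.compatible ε :=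
  ricci_eq_of_divergence_eq hD.compatible hD'.compatible
    (isPureType_of_torsion_eq_zero hD.torsion_eq_zero)
    (isPureType_of_torsion_eq_zero hD'.torsion_eq_zero)
    (by funext e x; rw [hD.divergence_eq, hD'.divergence_eq]) ε

end Mixed

end CourantAlgebroid

end GenGeom

end

theorem proposition4p3 {n : ℕ} (hn : 0 < n)
    {M : Type*} [TopologicalSpace M] [T2Space M]
    [ChartedSpace (EuclideanSpace ℝ (Fin n)) M] [IsManifold (𝓡 n) ∞ M]
    {F : Type*} [NormedAddCommGroup F] [NormedSpace ℝ F] [FiniteDimensional ℝ F]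
    {E : M → Type*} [TopologicalSpace (Bundle.TotalSpace F E)]
    [∀ x, AddCommGroup (E x)] [∀ x, Module ℝ (E x)] [∀ x, TopologicalSpace (E x)]
    [∀ x, IsTopologicalAddGroup (E x)] [∀ x, ContinuousSMul ℝ (E x)]
    [FiberBundle F E] [VectorBundle ℝ F E] [ContMDiffVectorBundle ∞ F E (𝓡 n)]
    (A : GenGeom.CourantAlgebroid n F E) (V : A.GeneralizedMetric) :
    (∀ (D D' : A.GeneralizedConnection) (hD : D.IsCompatible V) (hD' : D'.IsCompatible V),
      D.divergence = D'.divergence → D.torsion = 0 → V.IsPureType D'.torsion →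
        ∀ ε : ℤˣ, GenGeom.CourantAlgebroid.ricci hD ε = GenGeom.CourantAlgebroid.ricci hD' ε) ∧
    (∀ div : A.DivergenceOperator,
      (∃ D : A.GeneralizedConnection, GenGeom.CourantAlgebroid.IsLeviCivita V div D) →
        ∃! Ric : (ε : ℤˣ) → (V.secs (-ε) →ₗ[GenGeom.SmoothFn n M] V.secs ε
            →ₗ[GenGeom.SmoothFn n M] GenGeom.SmoothFn n M),
          ∀ (D : A.GeneralizedConnection)
            (hD : GenGeom.CourantAlgebroid.IsLeviCivita V div D) (ε : ℤˣ),
            GenGeom.CourantAlgebroid.ricci hD.compatible ε = Ric ε) := by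
  refine ⟨fun D D' hD hD' hdiv hT hT' ε =>
    GenGeom.CourantAlgebroid.ricci_eq_of_divergence_eq hD hD'
      (GenGeom.CourantAlgebroid.isPureType_of_torsion_eq_zero hT) hT' hdiv ε, ?_⟩
  rintro div ⟨D₀, hD₀⟩
  refine ⟨fun ε => GenGeom.CourantAlgebroid.ricci hD₀.compatible ε,
    fun D hD ε => hD.ricci_eq hD₀ ε, fun Ric hRic => ?_⟩
  funext ε
  -- Uniqueness rests on nonemptiness: any candidate must equal the Ricci tensor of `D₀`.
  exact (hRic D₀ hD₀ ε).symm
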